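/- Let $H$ be a complex Hilbert space, let $A,B$ be compact self-adjoint operators on $H$, and let $\rho$ be a state, i.e. a positive trace-class operator with $\mathrm{tr}[\rho]=1$. For $a\in\mathbb R$ let $P_A(a)$ be the spectral projection of $A$ at $a$, i.e. the orthogonal projection onto $\ker(A-a)$, and likewise $P_B(b)$. Let $\Pi_A(a)(\rho)=P_A(a)\,\rho\,P_A(a)$ be the Lüders operation, $\Lambda_A(\rho)=\sum_{a\in\sigma(A)}\Pi_A(a)(\rho)$ the post-measurement state of the non-selective measurement of $A$, and $$P^{A\to B}_\rho(a\to b)=\mathrm{tr}\big[\Pi_A(a)(\rho)\,P_B(b)\big]$$ the operational joint probability. For $\alpha\in\mathbb R$ put $$\hat\#^{\alpha}(s,t)=\tfrac{1+\alpha}{2}\,e^{-isA}e^{-itB}+\tfrac{1-\alpha}{2}\,e^{-itB}e^{-isA},\qquad \hat\#^{\mathrm{KD}}(s,t)=e^{-isA}e^{-itB},$$ let $\#$ be the inverse Fourier transform of $\hat\#$, i.e. the operator-valued distribution on $\mathbb R^2$ $$\#(\varphi)=\frac{1}{(2\pi)^2}\int_{\mathbb R^2}\Big(\int_{\mathbb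 R^2}\varphi(a,b)\,e^{i(sa+tb)}\,da\,db\Big)\hat\#(s,t)\,ds\,dt\qquad(\varphi\in\mathcal S(\mathbb R^2)),$$ and for a state $\tau$ let $P^{\#}_{\tau}(\varphi)=\mathrm{tr}[\tau\,\#(\varphi)]$ be the quasi-joint probability distribution of $(A,B)$ in $\tau$; write $P^\alpha_\tau$ and $P^{\mathrm{KD}}_\tau$ for $\hat\#^\alpha$ and $\hat\#^{\mathrm{KD}}$. We say that a distribution $u$ on $\mathbb R^2$ has mass $c$ at a point $x$ if $u\big(\varphi(R(\cdot-x))\big)\to c\,\varphi(0)$ as $R\to\infty$ for every $\varphi\in\mathcal S(\mathbb R^2)$. Then the series defining $\Lambda_A(\rho)$ is (unconditionally) summable in operator norm, $\Lambda_A(\rho)$ is a state, and for every real $\alpha$ the operational joint probability equals the $\alpha$-quasi-joint probability in the post-measurement state, $P^{A\to B}_\rho(a\to b)=P^{\alpha}_{\Lambda_A(\rho)}(a,b)$, in each of the following senses: 1. as distributions on $\mathbb R^2$: for every $\varphi\in\mathcal S(\mathbb R^2)$, $P^\alpha_{\Lambda_A(\rho)}(\varphi)=\sum_{a\in\sigma(A),\,b\in\sigma(B)}P^{A\to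 B}_\rho(a\to b)\,\varphi(a,b)$, with an (unconditionally) summable right-hand side; 2. pointwise: for all $a,b\in\mathbb R$, $P^\alpha_{\Lambda_A(\rho)}$ has mass $P^{A\to B}_\rho(a\to b)$ at $(a,b)$; 3. explicitly: for all $a,b\in\mathbb R$, $P^{A\to B}_\rho(a\to b)=\mathrm{tr}\big[\Lambda_A(\rho)\big(\tfrac{1+\alpha}{2}P_A(a)P_B(b)+\tfrac{1-\alpha}{2}P_B(b)P_A(a)\big)\big]$. In particular the Kirkwood–Dirac distribution of $\Lambda_A(\rho)$ is real: $P^{\mathrm{KD}}_{\Lambda_A(\rho)}(\varphi)\in\mathbb R$ for every real-valued $\varphi\in\mathcal S(\mathbb R^2)$, and $\mathrm{tr}[\Lambda_A(\rho)P_A(a)P_B(b)]\in\mathbb R$ for all $a,b\in\mathbb R$. -/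

import Mathlib

open Filter Topology MeasureTheory
open scoped SchwartzMap InnerProductSpace

namespace QuasiJoint

noncomputable section

section Trace

variable {H : Type*} [NormedAddCommGroup H] [InnerProductSpace ℂ H] [CompleteSpace H]

variable (H) in
/-- The index set of a fixed orthonormal (Hilbert) basis of `H`. -/
def basisIndex : Set H := (exists_hilbertBasis ℂ H).choose

variable (H) in
/-- A fixed orthonormal (Hilbert) basis of `H`. -/
def basis : HilbertBasis (basisIndex H) ℂ H := (exists_hilbertBasis ℂ H).choose_spec.choose

/-- `T` is trace class: `∑ᵢ ⟨eᵢ, |T| eᵢ⟩ < ∞`, where `|T| = (T† T)^{1/2}`.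
(The sum of a positive operator does not depend on the orthonormal basis.) -/
def IsTraceClass (T : H →L[ℂ] H) : Prop :=
  Summable fun i => (⟪basis H i, CFC.abs T (basis H i)⟫_ℂ).re

/-- The trace `tr[T] = ∑ᵢ ⟨eᵢ, T eᵢ⟩` (used for trace class operators only). -/
def trace (T : H →L[ℂ] H) : ℂ := ∑' i, ⟪basis H i, T (basis H i)⟫_ℂ

/-- The state space `S(H)`: positive trace class operators of trace one. -/
structure IsState (ρ : H →L[ℂ] H) : Prop where
  pos : ρ.IsPositive
  traceClass : IsTraceClass ρ
  trace_eq_one : trace ρ = 1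

end Trace

section Measurement

variable {H : Type*} [NormedAddCommGroup H] [InnerProductSpace ℂ H] [CompleteSpace H]

/-- The spectral projection `P_A(a)` of a compact self-adjoint operator at the point `a`: the
orthogonal projection onto `ker (A - a)` (zero when `a` is not an eigenvalue). -/
def specProj (A : H →L[ℂ] H) (a : ℝ) : H →L[ℂ] H :=
  (A - (a : ℂ) • (1 : H →L[ℂ] H)).ker.starProjection

/-- The Lüders operation `Π_A(a) : ρ ↦ P_A(a) ρ P_A(a)`. -/
def luders (A : H →L[ℂ] H) (a : ℝ) (ρ : H →L[ℂ] H) : H →L[ℂ] H :=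
  specProj A a * ρ * specProj A a

/-- The non-selective post-measurement state `Λ_A(ρ) = ∑_{a ∈ σ(A)} Π_A(a)(ρ)`. -/
def nonselective (A ρ : H →L[ℂ] H) : H →L[ℂ] H :=
  ∑' a : spectrum ℝ A, luders A a ρ

/-- The operational joint probability `P_ρ^{A→B}(a→b) = tr[Π_A(a)(ρ) P_B(b)]`. -/
def opJointProb (A B ρ : H →L[ℂ] H) (a b : ℝ) : ℂ :=
  trace (luders A a ρ * specProj B b)

end Measurement

section QuasiJointDistributions

variable {H : Type*} [NormedAddCommGroup H] [InnerProductSpace ℂ H] [CompleteSpace H]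

/-- The unitary group `e^{-isA}`. -/
def unitaryGroup (A : H →L[ℂ] H) (s : ℝ) : H →L[ℂ] H :=
  NormedSpace.exp ((-(Complex.I * (s : ℂ))) • A)

/-- The Kirkwood–Dirac hashed operator `e^{-isA} e^{-itB}`. -/
def hashedKD (A B : H →L[ℂ] H) (s : ℝ × ℝ) : H →L[ℂ] H :=
  unitaryGroup A s.1 * unitaryGroup B s.2

/-- The hashed operator
`(1+α)/2 e^{-isA} e^{-itB} + (1-α)/2 e^{-itB} e^{-isA}`. -/
def hashedAlpha (α : ℝ) (A B : H →L[ℂ] H) (s : ℝ × ℝ) : H →L[ℂ] H :=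
  (((1 + α) / 2 : ℝ) : ℂ) • (unitaryGroup A s.1 * unitaryGroup B s.2) +
    (((1 - α) / 2 : ℝ) : ℂ) • (unitaryGroup B s.2 * unitaryGroup A s.1)

/-- The quasi-joint spectral distribution of a hashed operator `h`: its inverse Fourier transform,
as an operator-valued distribution on `ℝ²`,
`φ ↦ (2π)⁻² ∫ (∫ φ(x) e^{i s·x} dx) h(s) ds`.
The factor `(2π)⁻²` is the one for which `e^{-i s·x₀}` is sent to the Dirac mass at `x₀`. -/
def quasiJointSpectral (h : ℝ × ℝ → H →L[ℂ] H) (φ : 𝓢(ℝ × ℝ, ℂ)) : H →L[ℂ] H :=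
  (((2 * Real.pi : ℝ) : ℂ) ^ 2)⁻¹ •
    ∫ s : ℝ × ℝ,
      (∫ x : ℝ × ℝ, Complex.exp (Complex.I * ((s.1 * x.1 + s.2 * x.2 : ℝ) : ℂ)) * φ x) • h s

/-- The quasi-joint probability distribution `φ ↦ tr[ρ #(φ)]` of the state `ρ`. -/
def quasiJointProb (h : ℝ × ℝ → H →L[ℂ] H) (ρ : H →L[ℂ] H) (φ : 𝓢(ℝ × ℝ, ℂ)) : ℂ :=
  trace (ρ * quasiJointSpectral h φ)

/-- The rescaled test function `y ↦ φ (R (y - x))`. -/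
def zoom (x : ℝ × ℝ) (R : Set.Ioi (0 : ℝ)) (φ : 𝓢(ℝ × ℝ, ℂ)) : 𝓢(ℝ × ℝ, ℂ) :=
  SchwartzMap.compSubConstCLM ℂ x
    (SchwartzMap.compCLMOfContinuousLinearEquiv ℂ
      (ContinuousLinearEquiv.smulLeft (Units.mk0 (R : ℝ) (ne_of_gt R.2))) φ)

theorem zoom_apply (x : ℝ × ℝ) (R : Set.Ioi (0 : ℝ)) (φ : 𝓢(ℝ × ℝ, ℂ)) (y : ℝ × ℝ) :
    zoom x R φ y = φ ((R : ℝ) • (y - x)) := rfl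

/-- The distribution `u` on `ℝ²` has mass `c` at the point `x`: testing `u` against
`φ (R (· - x))` gives `c φ(0)` in the limit `R → ∞`, for each test function `φ`. -/
def HasPointMass (u : 𝓢(ℝ × ℝ, ℂ) → ℂ) (x : ℝ × ℝ) (c : ℂ) : Prop :=
  ∀ φ : 𝓢(ℝ × ℝ, ℂ), Tendsto (fun R : Set.Ioi (0 : ℝ) => u (zoom x R φ)) atTop (𝓝 (c * φ 0))

end QuasiJointDistributions

end

end QuasiJoint

namespace QuasiJoint

/-! ### Eigenspaces of a compact self-adjoint operator -/

section SpectralProjection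

variable {H : Type*} [NormedAddCommGroup H] [InnerProductSpace ℂ H]

/-! Write ρ = ∑ₖ |uₖ⟩⟨uₖ| with uₖ = ρ^{1/2} eₖ. Then Λ_A(ρ) = ∑_{a,k} |w⟩⟨w| with w = P_A(a) uₖ, a
mixture of eigenvectors of A (`IsVectorDecomposition.nonselective`), and tr[Λ_A(ρ) T] = ∑ ⟨w, T w⟩
(`IsVectorDecomposition.hasSum_trace`). On an eigenvector w, e^{-isA} contributes the scalar
e^{-isa} from either side, so both orderings have the same expectation and α drops out
(`inner_hashedAlpha_self`). Expanding w over the eigenspaces of B (`hasSum_specProj`) leaves pure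
phases e^{-i(sa+tb)}, which Fourier inversion (`integral_phaseIntegral_mul_exp`) turns into φ(a,b)
with weight ‖P_B(b) w‖².

Everything thus reduces to the triple family ‖P_B(b) P_A(a) uₖ‖², summable by Pythagoras. Summing
over b first gives the quasi-joint side, over k first the operational side
(`hasSum_quasiJointProb`). Point masses follow by dominated convergence, and reality because the
weights are real. -/

theorem mem_ker_sub_smul_iff (A : H →L[ℂ] H) (a : ℝ) (x : H) :
    x ∈ (A - (a : ℂ) • (1 : H →L[ℂ] H)).ker ↔ A x = (a : ℂ) • x := by
  simp [LinearMap.mem_ker, sub_eq_zero]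

theorem eq_zero_of_notMem_spectrum {A : H →L[ℂ] H} {a : ℝ} (ha : a ∉ spectrum ℝ A) {x : H}
    (hx : A x = (a : ℂ) • x) : x = 0 := by
  obtain ⟨u, hu⟩ := spectrum.notMem_iff.1 ha
  have h1 : (u : H →L[ℂ] H) x = 0 := by
    rw [hu, Algebra.algebraMap_eq_smul_one]
    simp [hx]
  calc x = ((↑u⁻¹ : H →L[ℂ] H) * (u : H →L[ℂ] H)) x := by rw [u.inv_mul]; rfl
    _ = 0 := by rw [mul_apply_eq_comp, h1, map_zero]

variable [CompleteSpace H]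

theorem inner_specProj_left (A : H →L[ℂ] H) (a : ℝ) (x y : H) :
    ⟪specProj A a x, y⟫_ℂ = ⟪x, specProj A a y⟫_ℂ :=
  Submodule.inner_starProjection_left_eq_right _ x y

theorem apply_specProj (A : H →L[ℂ] H) (a : ℝ) (x : H) :
    A (specProj A a x) = (a : ℂ) • specProj A a x :=
  (mem_ker_sub_smul_iff A a _).1 (Submodule.starProjection_apply_mem _ x)

theorem specProj_eq_self {A : H →L[ℂ] H} {a : ℝ} {x : H} (hx : A x = (a : ℂ) • x) :
    specProj A a x = x :=
  Submodule.starProjection_eq_self_iff.2 ((mem_ker_sub_smul_iff A a x).2 hx)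

theorem specProj_specProj (A : H →L[ℂ] H) (a : ℝ) (x : H) :
    specProj A a (specProj A a x) = specProj A a x :=
  specProj_eq_self (apply_specProj A a x)

theorem inner_specProj_self (A : H →L[ℂ] H) (a : ℝ) (x : H) :
    ⟪x, specProj A a x⟫_ℂ = ((‖specProj A a x‖ ^ 2 : ℝ) : ℂ) := by
  rw [← specProj_specProj, ← inner_specProj_left, inner_self_eq_norm_sq_to_K,
    specProj_specProj]
  norm_cast

theorem inner_eq_zero_of_apply_eq_smul {A : H →L[ℂ] H} (hA : IsSelfAdjoint A) {a b : ℝ}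
    (hab : a ≠ b) {x y : H} (hx : A x = (a : ℂ) • x) (hy : A y = (b : ℂ) • y) :
    ⟪x, y⟫_ℂ = 0 := by
  have h : ⟪A x, y⟫_ℂ = ⟪x, A y⟫_ℂ := hA.isSymmetric x y
  rw [hx, hy, inner_smul_left, inner_smul_right, Complex.conj_ofReal] at h
  have h' : ((a : ℂ) - b) * ⟪x, y⟫_ℂ = 0 := by rw [sub_mul, h, sub_self]
  rcases mul_eq_zero.1 h' with h0 | h0
  · exact absurd (by exact_mod_cast sub_eq_zero.1 h0) hab
  · exact h0

theorem specProj_eq_zero_of_ne {A : H →L[ℂ] H} (hA : IsSelfAdjoint A) {a b : ℝ}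
    (hab : a ≠ b) {x : H} (hx : A x = (b : ℂ) • x) : specProj A a x = 0 := by
  rw [← inner_self_eq_zero (𝕜 := ℂ), inner_specProj_left, specProj_specProj,
    ← inner_specProj_left]
  exact inner_eq_zero_of_apply_eq_smul hA hab (apply_specProj A a x) hx

theorem specProj_eq_zero_of_notMem {A : H →L[ℂ] H} {a : ℝ} (ha : a ∉ spectrum ℝ A) :
    specProj A a = 0 := by
  ext x
  exact eq_zero_of_notMem_spectrum ha (apply_specProj A a x)

theorem orthogonalFamily_ker {A : H →L[ℂ] H} (hA : IsSelfAdjoint A) :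
    OrthogonalFamily ℂ
      (fun a : spectrum ℝ A => (A - ((a : ℝ) : ℂ) • (1 : H →L[ℂ] H)).ker)
      fun a => ((A - ((a : ℝ) : ℂ) • (1 : H →L[ℂ] H)).ker).subtypeₗᵢ := by
  intro a b hab x y
  exact inner_eq_zero_of_apply_eq_smul hA (fun h => hab (Subtype.ext h))
    ((mem_ker_sub_smul_iff A a _).1 x.2) ((mem_ker_sub_smul_iff A b _).1 y.2)

/-- The complex eigenspaces have trivial joint orthogonal complement. Eigenvalues are real and lie
in the real spectrum, so each nonzero eigenspace is one of the kernels indexed here. -/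
theorem top_le_closure_iSup_ker {A : H →L[ℂ] H} (hA : IsSelfAdjoint A)
    (hc : IsCompactOperator A) :
    (⊤ : Submodule ℂ H) ≤
      (⨆ a : spectrum ℝ A, (A - ((a : ℝ) : ℂ) • (1 : H →L[ℂ] H)).ker).topologicalClosure := by
  have hbot := ContinuousLinearMap.orthogonalComplement_iSup_eigenspaces_eq_bot hc hA.isSymmetric
  have hle : (⨆ μ : ℂ, Module.End.eigenspace (A : H →ₗ[ℂ] H) μ) ≤
      ⨆ a : spectrum ℝ A, (A - ((a : ℝ) : ℂ) • (1 : H →L[ℂ] H)).ker := by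
    refine iSup_le fun μ => ?_
    by_cases hμ : Module.End.HasEigenvalue (A : H →ₗ[ℂ] H) μ
    · have hre : ((μ.re : ℝ) : ℂ) = μ :=
        Complex.conj_eq_iff_re.1 (hA.isSymmetric.conj_eigenvalue_eq_self hμ)
      obtain ⟨v, hv, hv0⟩ := hμ.exists_hasEigenvector
      have hv' : A v = ((μ.re : ℝ) : ℂ) • v := by
        rw [hre]; exact Module.End.mem_eigenspace_iff.1 hv
      have hmem : μ.re ∈ spectrum ℝ A := by
        by_contra h
        exact hv0 (eq_zero_of_notMem_spectrum h hv')
      refine le_trans (fun x hx => ?_) (le_iSup _ (⟨μ.re, hmem⟩ : spectrum ℝ A))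
      rw [mem_ker_sub_smul_iff]
      change A x = ((μ.re : ℝ) : ℂ) • x
      rw [hre]; exact Module.End.mem_eigenspace_iff.1 hx
    · rw [Module.End.hasEigenvalue_iff, not_not] at hμ
      rw [hμ]; exact bot_le
  have : (⨆ a : spectrum ℝ A, (A - ((a : ℝ) : ℂ) • (1 : H →L[ℂ] H)).ker)ᗮ = ⊥ :=
    le_bot_iff.1 ((Submodule.orthogonal_le hle).trans hbot.le)
  rw [Submodule.topologicalClosure_eq_top_iff.2 this]

/-- The spectral theorem for a compact self-adjoint operator: its spectral projections resolve
the identity. -/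
theorem hasSum_specProj {A : H →L[ℂ] H} (hA : IsSelfAdjoint A) (hc : IsCompactOperator A)
    (x : H) : HasSum (fun a : spectrum ℝ A => specProj A a x) x := by
  have hV := IsHilbertSum.mkInternal (F := fun a : spectrum ℝ A =>
    (A - ((a : ℝ) : ℂ) • (1 : H →L[ℂ] H)).ker) (orthogonalFamily_ker hA)
    (top_le_closure_iSup_ker hA hc)
  set w := hV.linearIsometryEquiv x with hw
  have hs := hV.hasSum_linearIsometryEquiv_symm w
  rw [hw, LinearIsometryEquiv.symm_apply_apply, ← hw] at hs
  -- Applying P_A(a) to the Hilbert sum kills every component except the one at `a`.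
  have key : ∀ a : spectrum ℝ A, specProj A a x = (w a : H) := fun a => by
    have h1 := (specProj A a).hasSum hs
    refine h1.unique ?_
    have h2 : ∀ b : spectrum ℝ A, A (w b : H) = ((b : ℝ) : ℂ) • (w b : H) := fun b =>
      (mem_ker_sub_smul_iff A b _).1 (w b).2
    convert hasSum_single a fun b hb => ?_ using 1
    · exact (specProj_eq_self (h2 a)).symm
    · exact specProj_eq_zero_of_ne hA (fun h => hb (Subtype.ext h.symm)) (h2 b)
  simpa only [key] using! hs

theorem hasSum_inner_specProj {A : H →L[ℂ] H} (hA : IsSelfAdjoint A)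
    (hc : IsCompactOperator A) (x : H) :
    HasSum (fun a : spectrum ℝ A => ‖specProj A a x‖ ^ 2) (‖x‖ ^ 2) := by
  have h := (innerSL ℂ x).hasSum (hasSum_specProj hA hc x)
  simp only [innerSL_apply_apply, inner_specProj_self, inner_self_eq_norm_sq_to_K] at h
  norm_cast at h
  exact Complex.hasSum_ofReal.1 h

end SpectralProjection

/-! ### Rank-one decompositions of positive trace-class operators -/

section VectorDecomposition

variable {H : Type*} [NormedAddCommGroup H] [InnerProductSpace ℂ H]
  {κ : Type*}

theorem hasSum_norm_inner_sq {ι : Type*} (b : HilbertBasis ι ℂ H) (x : H) :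
    HasSum (fun i => ‖⟪b i, x⟫_ℂ‖ ^ 2) (‖x‖ ^ 2) := by
  have h := b.hasSum_inner_mul_inner x x
  simp only [inner_self_eq_norm_sq_to_K] at h
  have e : ∀ i, ⟪x, b i⟫_ℂ * ⟪b i, x⟫_ℂ = ((‖⟪b i, x⟫_ℂ‖ ^ 2 : ℝ) : ℂ) := fun i => by
    rw [← inner_conj_symm, Complex.conj_mul']
    norm_cast
  simp only [e] at h
  norm_cast at h
  exact Complex.hasSum_ofReal.1 h

theorem summable_norm_inner_sq {ι : Type*} (b : HilbertBasis ι ℂ H) {w : κ → H}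
    (hw : Summable fun k => ‖w k‖ ^ 2) :
    Summable fun p : κ × ι => ‖⟪b p.2, w p.1⟫_ℂ‖ ^ 2 := by
  refine (summable_prod_of_nonneg fun p => sq_nonneg _).2
    ⟨fun k => (hasSum_norm_inner_sq b (w k)).summable, ?_⟩
  simpa only [(hasSum_norm_inner_sq b (w _)).tsum_eq] using hw

theorem norm_sq_apply_le (T : H →L[ℂ] H) (x : H) : ‖T x‖ ^ 2 ≤ ‖T‖ ^ 2 * ‖x‖ ^ 2 := by
  rw [← mul_pow]
  exact pow_le_pow_left₀ (norm_nonneg _) (T.le_opNorm x) 2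

/-- `σ = ∑ₖ |wₖ⟩⟨wₖ|` weakly, with `∑ₖ ‖wₖ‖² < ∞`. -/
structure IsVectorDecomposition (w : κ → H) (σ : H →L[ℂ] H) : Prop where
  summable : Summable fun k => ‖w k‖ ^ 2
  hasSum_inner : ∀ x y, HasSum (fun k => ⟪x, w k⟫_ℂ * ⟪w k, y⟫_ℂ) ⟪x, σ y⟫_ℂ

namespace IsVectorDecomposition

variable {w : κ → H} {σ : H →L[ℂ] H}

theorem hasSum_inner_self (h : IsVectorDecomposition w σ) (x : H) :
    HasSum (fun k => ((‖⟪w k, x⟫_ℂ‖ ^ 2 : ℝ) : ℂ)) ⟪x, σ x⟫_ℂ := by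
  convert h.hasSum_inner x x using 2 with k
  rw [← inner_conj_symm x, Complex.conj_mul']
  norm_cast

theorem inner_self_eq (h : IsVectorDecomposition w σ) (x : H) :
    ⟪x, σ x⟫_ℂ = ((∑' k, ‖⟪w k, x⟫_ℂ‖ ^ 2 : ℝ) : ℂ) := by
  rw [Complex.ofReal_tsum, (h.hasSum_inner_self x).tsum_eq]

theorem isPositive (h : IsVectorDecomposition w σ) : σ.IsPositive := by
  rw [ContinuousLinearMap.isPositive_iff_complex]
  intro x
  have h0 : (0 : ℝ) ≤ ∑' k, ‖⟪w k, x⟫_ℂ‖ ^ 2 := tsum_nonneg fun k => sq_nonneg _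
  rw [← inner_conj_symm, h.inner_self_eq, Complex.conj_ofReal]
  simpa using h0

/-- Testing the weak identity at x = σ y, Cauchy–Schwarz gives ‖σ y‖² ≤ ‖σ y‖ (∑ ‖wₖ‖²) ‖y‖. This
bound yields operator-norm summability of the Lüders terms. -/
theorem norm_le (h : IsVectorDecomposition w σ) : ‖σ‖ ≤ ∑' k, ‖w k‖ ^ 2 := by
  have h0 : (0 : ℝ) ≤ ∑' k, ‖w k‖ ^ 2 := tsum_nonneg fun k => sq_nonneg _
  refine σ.opNorm_le_bound h0 fun y => ?_
  have h1 : ‖σ y‖ * ‖σ y‖ ≤ ‖σ y‖ * ((∑' k, ‖w k‖ ^ 2) * ‖y‖) := by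
    have hg : HasSum (fun k => ‖σ y‖ * (‖w k‖ ^ 2 * ‖y‖))
        (‖σ y‖ * ((∑' k, ‖w k‖ ^ 2) * ‖y‖)) := (h.summable.hasSum.mul_right _).mul_left _
    have hb := tsum_of_norm_bounded hg (f := fun k => ⟪σ y, w k⟫_ℂ * ⟪w k, y⟫_ℂ) fun k => by
      rw [norm_mul]
      refine (mul_le_mul (norm_inner_le_norm _ _) (norm_inner_le_norm _ _)
        (norm_nonneg _) (by positivity)).trans_eq (by ring)
    rwa [(h.hasSum_inner (σ y) y).tsum_eq, inner_self_eq_norm_sq_to_K, norm_pow,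
      RCLike.norm_ofReal, abs_norm, sq] at hb
  rcases (norm_nonneg (σ y)).eq_or_lt with h2 | h2
  · rw [← h2]; positivity
  · exact le_of_mul_le_mul_left h1 h2

theorem compress (h : IsVectorDecomposition w σ) {P : H →L[ℂ] H}
    (hP : ∀ x y, ⟪P x, y⟫_ℂ = ⟪x, P y⟫_ℂ) :
    IsVectorDecomposition (fun k => P (w k)) (P * σ * P) where
  summable := Summable.of_nonneg_of_le (fun _ => sq_nonneg _) (fun k => norm_sq_apply_le _ _)
      (h.summable.mul_left _)
  hasSum_inner x y := by
    have e : ⟪x, (P * σ * P) y⟫_ℂ = ⟪P x, σ (P y)⟫_ℂ := (hP x _).symm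
    rw [e]
    refine (h.hasSum_inner (P x) (P y)).congr_fun fun k => ?_
    rw [hP (w k) y, hP x (w k)]

variable [CompleteSpace H]

/-- Fubini for ⟨bᵢ, wₖ⟩⟨wₖ, T bᵢ⟩, which is dominated by a sum of two summable squares. Summing over
i first is Parseval for T†wₖ and wₖ; summing over k first gives the diagonal entries of σT. -/
theorem hasSum_trace (h : IsVectorDecomposition w σ) (T : H →L[ℂ] H) :
    HasSum (fun k => ⟪w k, T (w k)⟫_ℂ) (trace (σ * T)) := by
  set b := basis H
  have hT : Summable fun k => ‖T.adjoint (w k)‖ ^ 2 :=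
    Summable.of_nonneg_of_le (fun _ => sq_nonneg _) (fun k => norm_sq_apply_le _ _)
      (h.summable.mul_left _)
  have hf : Summable fun p : κ × basisIndex H =>
      ⟪b p.2, w p.1⟫_ℂ * ⟪w p.1, T (b p.2)⟫_ℂ := by
    refine Summable.of_norm_bounded
      ((summable_norm_inner_sq b h.summable).add (summable_norm_inner_sq b hT)) fun p => ?_
    rw [norm_mul, ← ContinuousLinearMap.adjoint_inner_left, norm_inner_symm (T.adjoint _)]
    nlinarith [sq_nonneg (‖⟪b p.2, w p.1⟫_ℂ‖ - ‖⟪b p.2, T.adjoint (w p.1)⟫_ℂ‖),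
      norm_nonneg ⟪b p.2, w p.1⟫_ℂ, norm_nonneg ⟪b p.2, T.adjoint (w p.1)⟫_ℂ]
  have h1 := hf.hasSum.prod_fiberwise (g := fun k => ⟪w k, T (w k)⟫_ℂ) fun k => by
    have := b.hasSum_inner_mul_inner (T.adjoint (w k)) (w k)
    simp only [ContinuousLinearMap.adjoint_inner_left] at this
    exact this.congr_fun fun i => mul_comm _ _
  have h2 := ((Equiv.prodComm (basisIndex H) κ).hasSum_iff.2 hf.hasSum).prod_fiberwise
    (g := fun i => ⟪b i, (σ * T) (b i)⟫_ℂ) fun i => h.hasSum_inner (b i) (T (b i))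
  rwa [trace, h2.tsum_eq]

/-- Positivity gives |σ| = σ, whose diagonal sum is the double sum of |⟨wₖ, eᵢ⟩|², finite by
Parseval. -/
theorem isTraceClass (h : IsVectorDecomposition w σ) : IsTraceClass σ := by
  rw [IsTraceClass, CFC.abs_of_nonneg σ
    ((ContinuousLinearMap.nonneg_iff_isPositive σ).2 h.isPositive)]
  simp only [h.inner_self_eq, Complex.ofReal_re]
  have := (summable_norm_inner_sq (basis H) h.summable).prod_symm.prod
  simpa only [Prod.swap, norm_inner_symm] using! this

theorem trace_eq (h : IsVectorDecomposition w σ) :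
    trace σ = ((∑' k, ‖w k‖ ^ 2 : ℝ) : ℂ) := by
  rw [← mul_one σ, ← (h.hasSum_trace 1).tsum_eq, Complex.ofReal_tsum]
  refine tsum_congr fun k => ?_
  rw [one_apply_eq_self, inner_self_eq_norm_sq_to_K]
  norm_cast

end IsVectorDecomposition

variable [CompleteSpace H]

/-- A state decomposes along the images of a Hilbert basis under its square root. -/
theorem IsState.exists_isVectorDecomposition {ρ : H →L[ℂ] H} (hρ : IsState ρ) :
    ∃ u : basisIndex H → H, IsVectorDecomposition u ρ := by
  have h0 : 0 ≤ ρ := (ContinuousLinearMap.nonneg_iff_isPositive ρ).2 hρ.pos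
  set S := CFC.sqrt ρ with hS
  have hsa : IsSelfAdjoint S := IsSelfAdjoint.of_nonneg (CFC.sqrt_nonneg ρ)
  have hsym : ∀ x y, ⟪S x, y⟫_ℂ = ⟪x, S y⟫_ℂ := hsa.isSymmetric
  have hSS : ∀ x y, ⟪S x, S y⟫_ℂ = ⟪x, ρ y⟫_ℂ := fun x y => by
    rw [hsym, ← mul_apply_eq_comp, CFC.sqrt_mul_sqrt_self ρ h0]
  refine ⟨fun i => S (basis H i), ?_, fun x y => ?_⟩
  -- Since ⟨eᵢ, ρ eᵢ⟩ = ‖S eᵢ‖², the trace-class condition is exactly the required square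
  -- summability.
  · have := hρ.traceClass
    rw [IsTraceClass, CFC.abs_of_nonneg ρ h0] at this
    refine this.congr fun i => ?_
    rw [← hSS, inner_self_eq_norm_sq_to_K]
    norm_cast
  · rw [← hSS]
    refine ((basis H).hasSum_inner_mul_inner (S x) (S y)).congr_fun fun i => ?_
    rw [hsym _ y, hsym x]

end VectorDecomposition

/-! ### Fourier inversion with the e^{i s·x} normalization -/

section Fourier

open scoped FourierTransform

/-- The integral `∫ e^{i s·x} φ(x) dx`. -/
noncomputable def phaseIntegral (φ : 𝓢(ℝ × ℝ, ℂ)) (s : ℝ × ℝ) : ℂ :=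
  ∫ x : ℝ × ℝ, Complex.exp (Complex.I * ((s.1 * x.1 + s.2 * x.2 : ℝ) : ℂ)) * φ x

/-- A Schwartz function on `ℝ × ℝ`, viewed on the Euclidean plane. -/
noncomputable def toEuclideanPlane (φ : 𝓢(ℝ × ℝ, ℂ)) : 𝓢(WithLp 2 (ℝ × ℝ), ℂ) :=
  SchwartzMap.compCLMOfContinuousLinearEquiv ℂ (WithLp.prodContinuousLinearEquiv 2 ℝ ℝ ℝ) φ

theorem integral_euclideanPlane (f : WithLp 2 (ℝ × ℝ) → ℂ) :
    ∫ v, f v = ∫ x : ℝ × ℝ, f (WithLp.toLp 2 x) :=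
  ((WithLp.volume_preserving_toLp ℝ ℝ).integral_comp
    (MeasurableEquiv.toLp 2 (ℝ × ℝ)).measurableEmbedding f).symm

/-- The transform `𝓕⁻` uses an inner product and the phase e^{2πi⟨·,·⟩}: hence the Euclidean plane
and the dilation by (2π)⁻¹. -/
theorem phaseIntegral_eq (φ : 𝓢(ℝ × ℝ, ℂ)) (s : ℝ × ℝ) :
    phaseIntegral φ s = 𝓕⁻ (toEuclideanPlane φ) (WithLp.toLp 2 ((2 * Real.pi)⁻¹ • s)) := by
  rw [SchwartzMap.fourierInv_coe, Real.fourierInv_eq', integral_euclideanPlane, phaseIntegral]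
  congr 1 with x
  rw [smul_eq_mul]
  congr 2
  simp only [WithLp.prod_inner_apply, RCLike.inner_apply, conj_trivial, Prod.smul_fst,
    Prod.smul_snd, smul_eq_mul]
  rw [mul_comm Complex.I]
  congr 2
  field_simp

theorem integrable_phaseIntegral (φ : 𝓢(ℝ × ℝ, ℂ)) : Integrable (phaseIntegral φ) := by
  have h1 : Integrable fun x : ℝ × ℝ => 𝓕⁻ (toEuclideanPlane φ) (WithLp.toLp 2 x) :=
    (WithLp.volume_preserving_toLp ℝ ℝ).integrable_comp_of_integrable
      (𝓕⁻ (toEuclideanPlane φ)).integrable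
  have h2 := h1.comp_smul (R := (2 * Real.pi)⁻¹) (by positivity)
  exact h2.congr (ae_of_all _ fun s => (phaseIntegral_eq φ s).symm)

/-- Fourier inversion on `ℝ × ℝ`. -/
theorem integral_phaseIntegral_mul_exp (φ : 𝓢(ℝ × ℝ, ℂ)) (x : ℝ × ℝ) :
    (((2 * Real.pi : ℝ) : ℂ) ^ 2)⁻¹ * ∫ s : ℝ × ℝ, phaseIntegral φ s *
      Complex.exp (-(Complex.I * ((s.1 * x.1 + s.2 * x.2 : ℝ) : ℂ))) = φ x := by
  have h1 : 𝓕 (𝓕⁻ (toEuclideanPlane φ)) (WithLp.toLp 2 x) = φ x := by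
    rw [FourierTransform.fourier_fourierInv_eq]
    rfl
  rw [SchwartzMap.fourier_coe, Real.fourier_eq', integral_euclideanPlane] at h1
  -- Undoing the dilation has Jacobian (2π)² in dimension two, which cancels the prefactor.
  have h2 := Measure.integral_comp_smul (volume : Measure (ℝ × ℝ)) (fun y : ℝ × ℝ =>
    Complex.exp (((-2 * Real.pi * ⟪WithLp.toLp 2 y, WithLp.toLp 2 x⟫_ℝ : ℝ) : ℂ) * Complex.I) •
      𝓕⁻ (toEuclideanPlane φ) (WithLp.toLp 2 y)) (2 * Real.pi)⁻¹
  rw [h1] at h2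
  have h3 : ∫ s : ℝ × ℝ, phaseIntegral φ s *
      Complex.exp (-(Complex.I * ((s.1 * x.1 + s.2 * x.2 : ℝ) : ℂ))) =
      |(((2 * Real.pi)⁻¹ ^ Module.finrank ℝ (ℝ × ℝ))⁻¹ : ℝ)| • φ x := by
    rw [← h2]
    congr 1 with s
    rw [phaseIntegral_eq, smul_eq_mul, mul_comm]
    congr 2
    simp only [WithLp.prod_inner_apply, RCLike.inner_apply, conj_trivial, Prod.smul_fst,
      Prod.smul_snd, smul_eq_mul]
    rw [mul_comm Complex.I, ← neg_mul, ← Complex.ofReal_neg]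
    congr 2
    field_simp
  have h4 : |(((2 * Real.pi)⁻¹ ^ Module.finrank ℝ (ℝ × ℝ))⁻¹ : ℝ)| = (2 * Real.pi) ^ 2 := by
    rw [Module.finrank_prod, Module.finrank_self, inv_pow, inv_inv, abs_of_pos (by positivity)]
  have h5 : ((2 * Real.pi : ℝ) : ℂ) ≠ 0 := by exact_mod_cast (by positivity : (2 * Real.pi : ℝ) ≠ 0)
  rw [h3, h4, Complex.real_smul, Complex.ofReal_pow, inv_mul_cancel_left₀ (pow_ne_zero 2 h5)]

end Fourier

/-! ### The unitary groups on eigenvectors -/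

section Propagator

variable {H : Type*} [NormedAddCommGroup H] [InnerProductSpace ℂ H] [CompleteSpace H]

theorem exp_apply_of_apply_eq_smul {T : H →L[ℂ] H} {c : ℂ} {x : H} (hx : T x = c • x) :
    NormedSpace.exp T x = Complex.exp c • x := by
  have hp : ∀ n : ℕ, (T ^ n) x = c ^ n • x := fun n => by
    induction n with
    | zero => simp
    | succ n ih => rw [pow_succ, mul_apply_eq_comp, hx, map_smul, ih, smul_smul, pow_succ']
  have h1 := (ContinuousLinearMap.apply ℂ H x).hasSum
    (NormedSpace.exp_series_hasSum_exp' (𝕂 := ℂ) T)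
  have h2 := (NormedSpace.exp_series_hasSum_exp' (𝕂 := ℂ) c).smul_const x
  rw [← Complex.exp_eq_exp_ℂ] at h2
  refine h1.unique (h2.congr_fun fun n => ?_)
  simp [hp, smul_smul]

theorem unitaryGroup_apply_of_apply_eq_smul {A : H →L[ℂ] H} {a : ℝ} {x : H}
    (hx : A x = (a : ℂ) • x) (s : ℝ) :
    unitaryGroup A s x = Complex.exp (-(Complex.I * ((s * a : ℝ) : ℂ))) • x := by
  refine exp_apply_of_apply_eq_smul ?_
  rw [smul_apply, hx, smul_smul]
  push_cast
  ring_nf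

theorem star_unitaryGroup {A : H →L[ℂ] H} (hA : IsSelfAdjoint A) (s : ℝ) :
    star (unitaryGroup A s) = unitaryGroup A (-s) := by
  rw [unitaryGroup, NormedSpace.star_exp, star_smul, hA.star_eq, unitaryGroup]
  congr 2
  simp

theorem inner_unitaryGroup_of_apply_eq_smul {A : H →L[ℂ] H} (hA : IsSelfAdjoint A) {a : ℝ}
    {x : H} (hx : A x = (a : ℂ) • x) (s : ℝ) (y : H) :
    ⟪x, unitaryGroup A s y⟫_ℂ = Complex.exp (-(Complex.I * ((s * a : ℝ) : ℂ))) * ⟪x, y⟫_ℂ := by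
  rw [← ContinuousLinearMap.adjoint_inner_left, ← ContinuousLinearMap.star_eq_adjoint,
    star_unitaryGroup hA, unitaryGroup_apply_of_apply_eq_smul hx, inner_smul_left,
    ← Complex.exp_conj]
  congr 2
  simp

theorem norm_unitaryGroup_le {A : H →L[ℂ] H} (hA : IsSelfAdjoint A) (s : ℝ) :
    ‖unitaryGroup A s‖ ≤ 1 := by
  let _ : NormedAlgebra ℚ (H →L[ℂ] H) := .restrictScalars ℚ ℂ _
  have h : star (unitaryGroup A s) * unitaryGroup A s = 1 := by
    rw [star_unitaryGroup hA, unitaryGroup, unitaryGroup, ← NormedSpace.exp_add_of_commute]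
    · rw [← add_smul]; simp
    · exact ((Commute.refl A).smul_left _).smul_right _
  have h1 : ‖unitaryGroup A s‖ * ‖unitaryGroup A s‖ ≤ 1 := by
    rw [← CStarRing.norm_star_mul_self, h]
    exact ContinuousLinearMap.norm_id_le
  nlinarith

theorem continuous_unitaryGroup (A : H →L[ℂ] H) : Continuous (unitaryGroup A) := by
  let _ : NormedAlgebra ℚ (H →L[ℂ] H) := .restrictScalars ℚ ℂ _
  exact NormedSpace.exp_continuous.comp (by fun_prop)

end Propagator

/-! ### Matrix elements of the quasi-joint spectral distribution -/

section Spectral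

variable {H : Type*} [NormedAddCommGroup H] [InnerProductSpace ℂ H] [CompleteSpace H]

theorem hashedAlpha_one (A B : H →L[ℂ] H) : hashedAlpha 1 A B = hashedKD A B := by
  ext s x
  simp [hashedAlpha, hashedKD]

theorem continuous_hashedAlpha (α : ℝ) (A B : H →L[ℂ] H) : Continuous (hashedAlpha α A B) := by
  have hA := (continuous_unitaryGroup A).comp (continuous_fst (X := ℝ) (Y := ℝ))
  have hB := (continuous_unitaryGroup B).comp (continuous_snd (X := ℝ) (Y := ℝ))
  exact ((hA.mul hB).const_smul (((1 + α) / 2 : ℝ) : ℂ)).add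
    ((hB.mul hA).const_smul (((1 - α) / 2 : ℝ) : ℂ))

theorem norm_hashedAlpha_le (α : ℝ) {A B : H →L[ℂ] H} (hA : IsSelfAdjoint A)
    (hB : IsSelfAdjoint B) (s : ℝ × ℝ) :
    ‖hashedAlpha α A B s‖ ≤ |(1 + α) / 2| + |(1 - α) / 2| := by
  have h1 : ‖unitaryGroup A s.1 * unitaryGroup B s.2‖ ≤ 1 :=
    (norm_mul_le _ _).trans (mul_le_one₀ (norm_unitaryGroup_le hA _) (norm_nonneg _)
      (norm_unitaryGroup_le hB _))
  have h2 : ‖unitaryGroup B s.2 * unitaryGroup A s.1‖ ≤ 1 :=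
    (norm_mul_le _ _).trans (mul_le_one₀ (norm_unitaryGroup_le hB _) (norm_nonneg _)
      (norm_unitaryGroup_le hA _))
  refine (norm_add_le _ _).trans (add_le_add ?_ ?_) <;>
    rw [norm_smul, Complex.norm_real, Real.norm_eq_abs] <;>
    exact mul_le_of_le_one_right (abs_nonneg _) ‹_›

theorem integrable_phaseIntegral_smul_hashedAlpha (α : ℝ) {A B : H →L[ℂ] H}
    (hA : IsSelfAdjoint A) (hB : IsSelfAdjoint B) (φ : 𝓢(ℝ × ℝ, ℂ)) :
    Integrable fun s => phaseIntegral φ s • hashedAlpha α A B s := by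
  refine ((integrable_phaseIntegral φ).norm.mul_const (|(1 + α) / 2| + |(1 - α) / 2|)).mono'
    ((integrable_phaseIntegral φ).aestronglyMeasurable.smul
      (continuous_hashedAlpha α A B).aestronglyMeasurable) (ae_of_all _ fun s => ?_)
  rw [norm_smul]
  exact mul_le_mul_of_nonneg_left (norm_hashedAlpha_le α hA hB s) (norm_nonneg _)

theorem inner_quasiJointSpectral {h : ℝ × ℝ → H →L[ℂ] H} {φ : 𝓢(ℝ × ℝ, ℂ)}
    (hi : Integrable fun s => phaseIntegral φ s • h s) (x y : H) :
    ⟪x, quasiJointSpectral h φ y⟫_ℂ =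
      (((2 * Real.pi : ℝ) : ℂ) ^ 2)⁻¹ * ∫ s, phaseIntegral φ s * ⟪x, h s y⟫_ℂ := by
  have := ((innerSL ℂ x).comp (ContinuousLinearMap.apply ℂ H y)).integral_comp_comm hi
  simp only [ContinuousLinearMap.comp_apply, ContinuousLinearMap.apply_apply,
    innerSL_apply_apply, smul_apply, inner_smul_right] at this
  rw [this, quasiJointSpectral, smul_apply, inner_smul_right]
  rfl

/-- In one ordering e^{-isA} acts on the left vector, in the other on the right; both give the phase
e^{-isa}, and the two weights add up to 1. -/
theorem inner_hashedAlpha_self {A B : H →L[ℂ] H} (hA : IsSelfAdjoint A) {a : ℝ} {w : H}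
    (hw : A w = (a : ℂ) • w) (α : ℝ) (s : ℝ × ℝ) :
    ⟪w, hashedAlpha α A B s w⟫_ℂ = ⟪w, hashedKD A B s w⟫_ℂ := by
  simp only [hashedAlpha, hashedKD, add_apply, smul_apply, mul_apply_eq_comp, inner_add_right,
    inner_smul_right, inner_unitaryGroup_of_apply_eq_smul hA hw,
    unitaryGroup_apply_of_apply_eq_smul hw, map_smul]
  rw [← add_mul, ← Complex.ofReal_add]
  ring_nf
  simp

theorem inner_hashedKD_of_apply_eq_smul {A B : H →L[ℂ] H} (hA : IsSelfAdjoint A) {a b : ℝ}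
    {w v : H} (hw : A w = (a : ℂ) • w) (hv : B v = (b : ℂ) • v) (s : ℝ × ℝ) :
    ⟪w, hashedKD A B s v⟫_ℂ =
      Complex.exp (-(Complex.I * ((s.1 * a + s.2 * b : ℝ) : ℂ))) * ⟪w, v⟫_ℂ := by
  rw [hashedKD, mul_apply_eq_comp, unitaryGroup_apply_of_apply_eq_smul hv, map_smul,
    inner_smul_right, inner_unitaryGroup_of_apply_eq_smul hA hw, ← mul_assoc, ← Complex.exp_add]
  congr 2
  push_cast
  ring

/-- The Kirkwood–Dirac ordering has A facing the left vector and B the right one, so the matrix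
element is a pure phase and Fourier inversion applies. -/
theorem inner_quasiJointSpectral_hashedKD {A B : H →L[ℂ] H} (hA : IsSelfAdjoint A)
    (hB : IsSelfAdjoint B) {a b : ℝ} {w v : H} (hw : A w = (a : ℂ) • w)
    (hv : B v = (b : ℂ) • v) (φ : 𝓢(ℝ × ℝ, ℂ)) :
    ⟪w, quasiJointSpectral (hashedKD A B) φ v⟫_ℂ = φ (a, b) * ⟪w, v⟫_ℂ := by
  have hi := integrable_phaseIntegral_smul_hashedAlpha 1 hA hB φ
  rw [hashedAlpha_one] at hi
  simp only [inner_quasiJointSpectral hi, inner_hashedKD_of_apply_eq_smul hA hw hv, ← mul_assoc]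
  rw [integral_mul_const, ← mul_assoc, integral_phaseIntegral_mul_exp φ (a, b)]

theorem hasSum_inner_quasiJointSpectral {A B : H →L[ℂ] H} (hA : IsSelfAdjoint A)
    (hB : IsSelfAdjoint B) (hBc : IsCompactOperator B) {a : ℝ} {w : H}
    (hw : A w = (a : ℂ) • w) (α : ℝ) (φ : 𝓢(ℝ × ℝ, ℂ)) :
    HasSum (fun b : spectrum ℝ B => ((‖specProj B b w‖ ^ 2 : ℝ) : ℂ) * φ (a, b))
      ⟪w, quasiJointSpectral (hashedAlpha α A B) φ w⟫_ℂ := by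
  have hi := integrable_phaseIntegral_smul_hashedAlpha 1 hA hB φ
  rw [hashedAlpha_one] at hi
  have e : ⟪w, quasiJointSpectral (hashedAlpha α A B) φ w⟫_ℂ =
      ⟪w, quasiJointSpectral (hashedKD A B) φ w⟫_ℂ := by
    rw [inner_quasiJointSpectral (integrable_phaseIntegral_smul_hashedAlpha α hA hB φ),
      inner_quasiJointSpectral hi]
    simp only [inner_hashedAlpha_self hA hw]
  -- The bounded functional ⟨w, #(φ) ·⟩ is applied termwise to w = ∑ P_B(b) w.
  have h := ((innerSL ℂ w).comp (quasiJointSpectral (hashedKD A B) φ)).hasSum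
    (hasSum_specProj hB hBc w)
  rw [e]
  refine h.congr_fun fun b => ?_
  rw [← inner_specProj_self, mul_comm]
  exact (inner_quasiJointSpectral_hashedKD hA hB hw (apply_specProj B b w) φ).symm

end Spectral

/-! ### The post-measurement state and its joint distributions -/

section Measurement

variable {H : Type*} [NormedAddCommGroup H] [InnerProductSpace ℂ H] [CompleteSpace H]
  {κ : Type*} {u : κ → H} {A B ρ : H →L[ℂ] H}

/-- Pythagoras for each uₖ, then Tonelli. The exact value of the sum is what makes Λ_A preserve the
trace. -/
theorem hasSum_norm_specProj_sq (hA : IsSelfAdjoint A) (hAc : IsCompactOperator A)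
    (hu : Summable fun k => ‖u k‖ ^ 2) :
    HasSum (fun p : spectrum ℝ A × κ => ‖specProj A p.1 (u p.2)‖ ^ 2) (∑' k, ‖u k‖ ^ 2) := by
  have h : Summable fun p : κ × spectrum ℝ A => ‖specProj A p.2 (u p.1)‖ ^ 2 :=
    (summable_prod_of_nonneg fun p => sq_nonneg _).2
      ⟨fun k => (hasSum_inner_specProj hA hAc (u k)).summable, by
        simpa only [(hasSum_inner_specProj hA hAc (u _)).tsum_eq] using hu⟩
  have h1 := h.hasSum.prod_fiberwise fun k => hasSum_inner_specProj hA hAc (u k)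
  rw [h1.tsum_eq]
  exact (Equiv.prodComm (spectrum ℝ A) κ).hasSum_iff.2 h.hasSum

theorem IsVectorDecomposition.luders (hu : IsVectorDecomposition u ρ) (a : ℝ) :
    IsVectorDecomposition (fun k => specProj A a (u k)) (luders A a ρ) :=
  hu.compress (inner_specProj_left A a)

theorem summable_luders (hA : IsSelfAdjoint A) (hAc : IsCompactOperator A)
    (hu : IsVectorDecomposition u ρ) :
    Summable fun a : spectrum ℝ A => luders A a ρ :=
  Summable.of_norm_bounded (hasSum_norm_specProj_sq hA hAc hu.summable).summable.prod
    fun a => (hu.luders (a : ℝ)).norm_le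

/-- Norm convergence of ∑ₐ Π_A(a)(ρ) allows matrix elements to be taken termwise; absolute
summability over (a,k) merges the resulting iterated sum into one. -/
theorem IsVectorDecomposition.nonselective (hA : IsSelfAdjoint A) (hAc : IsCompactOperator A)
    (hu : IsVectorDecomposition u ρ) :
    IsVectorDecomposition (fun p : spectrum ℝ A × κ => specProj A p.1 (u p.2))
      (nonselective A ρ) where
  summable := (hasSum_norm_specProj_sq hA hAc hu.summable).summable
  hasSum_inner x y := by
    have hs : Summable fun p : spectrum ℝ A × κ =>
        ⟪x, specProj A p.1 (u p.2)⟫_ℂ * ⟪specProj A p.1 (u p.2), y⟫_ℂ := by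
      refine Summable.of_norm_bounded (((hasSum_norm_specProj_sq hA hAc
        hu.summable).summable.mul_left ‖x‖).mul_right ‖y‖) fun p => ?_
      rw [norm_mul]
      exact (mul_le_mul (norm_inner_le_norm _ _) (norm_inner_le_norm _ _)
        (norm_nonneg _) (by positivity)).trans_eq (by ring)
    have h1 := hs.hasSum.prod_fiberwise fun a => (hu.luders (A := A) (a : ℝ)).hasSum_inner x y
    have h2 := ((innerSL ℂ x).comp (ContinuousLinearMap.apply ℂ H y)).hasSum
      (summable_luders hA hAc hu).hasSum
    rw [show ⟪x, QuasiJoint.nonselective A ρ y⟫_ℂ = _ from h2.unique h1]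
    exact hs.hasSum

theorem isState_nonselective (hA : IsSelfAdjoint A) (hAc : IsCompactOperator A)
    (hu : IsVectorDecomposition u ρ) (hρ : trace ρ = 1) : IsState (nonselective A ρ) where
  pos := (hu.nonselective hA hAc).isPositive
  traceClass := (hu.nonselective hA hAc).isTraceClass
  trace_eq_one := by
    rw [(hu.nonselective hA hAc).trace_eq,
      (hasSum_norm_specProj_sq hA hAc hu.summable).tsum_eq, ← hu.trace_eq, hρ]

theorem hasSum_opJointProb (hu : IsVectorDecomposition u ρ) (a b : ℝ) :
    HasSum (fun k => ((‖specProj B b (specProj A a (u k))‖ ^ 2 : ℝ) : ℂ))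
      (opJointProb A B ρ a b) := by
  simpa only [inner_specProj_self] using! (hu.luders (A := A) a).hasSum_trace (specProj B b)

theorem opJointProb_im (hu : IsVectorDecomposition u ρ) (a b : ℝ) :
    (opJointProb A B ρ a b).im = 0 := by
  rw [← (hasSum_opJointProb hu a b).tsum_eq, ← Complex.ofReal_tsum, Complex.ofReal_im]

/-- The equivalence `(X × Y) × Z ≃ (X × Z) × Y`. -/
def prodRightComm (X Y Z : Type*) : (X × Y) × Z ≃ (X × Z) × Y where
  toFun p := ((p.1.1, p.2), p.1.2)
  invFun p := ((p.1.1, p.2), p.1.2)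
  left_inv _ := rfl
  right_inv _ := rfl

/-- Pythagoras twice: for A on the uₖ, then for B on the family P_A(a) uₖ. -/
theorem summable_norm_specProj_specProj_sq (hA : IsSelfAdjoint A) (hAc : IsCompactOperator A)
    (hB : IsSelfAdjoint B) (hBc : IsCompactOperator B) (hu : Summable fun k => ‖u k‖ ^ 2) :
    Summable fun p : (spectrum ℝ A × κ) × spectrum ℝ B =>
      ‖specProj B p.2 (specProj A p.1.1 (u p.1.2))‖ ^ 2 :=
  (Equiv.prodComm _ _).summable_iff.2 (hasSum_norm_specProj_sq hB hBc
    (hasSum_norm_specProj_sq hA hAc hu).summable).summable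

theorem summable_opJointProb (hA : IsSelfAdjoint A) (hAc : IsCompactOperator A)
    (hB : IsSelfAdjoint B) (hBc : IsCompactOperator B) (hu : IsVectorDecomposition u ρ) :
    Summable fun p : spectrum ℝ A × spectrum ℝ B => opJointProb A B ρ p.1 p.2 := by
  have h := (prodRightComm (spectrum ℝ A) (spectrum ℝ B) κ).summable_iff.2
    (Complex.summable_ofReal.2 (summable_norm_specProj_specProj_sq hA hAc hB hBc hu.summable))
  exact (h.hasSum.prod_fiberwise fun p => hasSum_opJointProb hu p.1 p.2).summable

theorem hasSum_quasiJointProb (hA : IsSelfAdjoint A) (hAc : IsCompactOperator A)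
    (hB : IsSelfAdjoint B) (hBc : IsCompactOperator B) (hu : IsVectorDecomposition u ρ)
    (α : ℝ) (φ : 𝓢(ℝ × ℝ, ℂ)) :
    HasSum (fun p : spectrum ℝ A × spectrum ℝ B =>
        opJointProb A B ρ p.1 p.2 * φ ((p.1 : ℝ), (p.2 : ℝ)))
      (quasiJointProb (hashedAlpha α A B) (nonselective A ρ) φ) := by
  have hs : Summable fun p : (spectrum ℝ A × κ) × spectrum ℝ B =>
      ((‖specProj B p.2 (specProj A p.1.1 (u p.1.2))‖ ^ 2 : ℝ) : ℂ) *
        φ ((p.1.1 : ℝ), (p.2 : ℝ)) := by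
    refine Summable.of_norm_bounded ((summable_norm_specProj_specProj_sq hA hAc hB hBc
      hu.summable).mul_right (SchwartzMap.seminorm ℂ 0 0 φ)) fun p => ?_
    rw [norm_mul, Complex.norm_real, Real.norm_of_nonneg (sq_nonneg _)]
    exact mul_le_mul_of_nonneg_left (SchwartzMap.norm_le_seminorm ℂ φ _) (sq_nonneg _)
  have h1 := hs.hasSum.prod_fiberwise fun q =>
    hasSum_inner_quasiJointSpectral hA hB hBc (apply_specProj A q.1 (u q.2)) α φ
  -- The same triple sum, regrouped so that k is summed innermost.
  have h2 := (prodRightComm (spectrum ℝ A) (spectrum ℝ B) κ).hasSum_iff.2 hs.hasSum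
  rw [quasiJointProb, ((hu.nonselective hA hAc).hasSum_trace _).unique h1]
  exact h2.prod_fiberwise fun p =>
    (hasSum_opJointProb hu p.1 p.2).mul_right (φ ((p.1 : ℝ), (p.2 : ℝ)))

/-- For y ≠ x, R(y − x) leaves every compact set, and Schwartz functions vanish at infinity. -/
theorem tendsto_zoom (φ : 𝓢(ℝ × ℝ, ℂ)) {x y : ℝ × ℝ} (hxy : y ≠ x) :
    Tendsto (fun R : Set.Ioi (0 : ℝ) => zoom x R φ y) atTop (𝓝 0) := by
  have h : Tendsto (fun R : ℝ => R • (y - x)) atTop (cocompact (ℝ × ℝ)) := by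
    rw [← Metric.cobounded_eq_cocompact, ← tendsto_norm_atTop_iff_cobounded]
    simp only [norm_smul]
    exact tendsto_norm_atTop_atTop.atTop_mul_const (norm_pos_iff.2 (sub_ne_zero.2 hxy))
  exact tendsto_comp_val_Ioi_atTop.2 (φ.tendsto_cocompact.comp h)

theorem opJointProb_eq_zero_of_notMem_left {a : ℝ} (ha : a ∉ spectrum ℝ A) (b : ℝ) :
    opJointProb A B ρ a b = 0 := by
  simp [opJointProb, luders, specProj_eq_zero_of_notMem ha, trace]

theorem opJointProb_eq_zero_of_notMem_right (a : ℝ) {b : ℝ} (hb : b ∉ spectrum ℝ B) :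
    opJointProb A B ρ a b = 0 := by
  simp [opJointProb, specProj_eq_zero_of_notMem hb, trace]

theorem hasPointMass_quasiJointProb (hA : IsSelfAdjoint A) (hAc : IsCompactOperator A)
    (hB : IsSelfAdjoint B) (hBc : IsCompactOperator B) (hu : IsVectorDecomposition u ρ)
    (α a b : ℝ) :
    HasPointMass (quasiJointProb (hashedAlpha α A B) (nonselective A ρ)) (a, b)
      (opJointProb A B ρ a b) := by
  classical
  intro φ
  simp only [← (hasSum_quasiJointProb hA hAc hB hBc hu α _).tsum_eq]
  -- Zooming does not change the sup norm of φ, so one bound dominates for all R. In the limit only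
  -- the atom at (a,b) survives.
  have hlim := tendsto_tsum_of_dominated_convergence (𝓕 := atTop)
    (f := fun (R : Set.Ioi (0 : ℝ)) (p : spectrum ℝ A × spectrum ℝ B) =>
      opJointProb A B ρ p.1 p.2 * zoom (a, b) R φ ((p.1 : ℝ), (p.2 : ℝ)))
    (g := fun p => opJointProb A B ρ p.1 p.2 *
      if ((p.1 : ℝ), (p.2 : ℝ)) = (a, b) then φ 0 else 0)
    ((summable_opJointProb hA hAc hB hBc hu).norm.mul_right (SchwartzMap.seminorm ℂ 0 0 φ))
    (fun p => by
      refine Tendsto.const_mul _ ?_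
      split_ifs with hp
      · simp [hp, zoom_apply]
      · exact tendsto_zoom φ hp)
    (Eventually.of_forall fun R p => by
      rw [norm_mul, zoom_apply]
      exact mul_le_mul_of_nonneg_left (SchwartzMap.norm_le_seminorm ℂ φ _) (norm_nonneg _))
  convert hlim using 2
  -- Outside σ(A) × σ(B) no index matches (a,b), and the claimed mass is zero as well.
  by_cases ha : a ∈ spectrum ℝ A
  · by_cases hb : b ∈ spectrum ℝ B
    · rw [tsum_eq_single ((⟨a, ha⟩, ⟨b, hb⟩) : spectrum ℝ A × spectrum ℝ B)]
      · simp
      · rintro ⟨⟨a', ha'⟩, ⟨b', hb'⟩⟩ hne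
        rw [if_neg, mul_zero]
        simpa using hne
    · rw [opJointProb_eq_zero_of_notMem_right a hb, zero_mul, eq_comm]
      refine (tsum_congr fun p => ?_).trans tsum_zero
      rw [if_neg, mul_zero]
      intro h
      have h2 : (p.2 : ℝ) = b := congrArg Prod.snd h
      exact hb (h2 ▸ p.2.2)
  · rw [opJointProb_eq_zero_of_notMem_left ha, zero_mul, eq_comm]
    refine (tsum_congr fun p => ?_).trans tsum_zero
    rw [if_neg, mul_zero]
    intro h
    have h1 : (p.1 : ℝ) = a := congrArg Prod.fst h
    exact ha (h1 ▸ p.1.2)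

theorem opJointProb_eq_trace (hA : IsSelfAdjoint A) (hAc : IsCompactOperator A)
    (hu : IsVectorDecomposition u ρ) (α a b : ℝ) :
    opJointProb A B ρ a b =
      trace (nonselective A ρ *
        ((((1 + α) / 2 : ℝ) : ℂ) • (specProj A a * specProj B b) +
          (((1 - α) / 2 : ℝ) : ℂ) • (specProj B b * specProj A a))) := by
  by_cases ha : a ∈ spectrum ℝ A
  · have h := (hu.nonselective hA hAc).hasSum_trace
      ((((1 + α) / 2 : ℝ) : ℂ) • (specProj A a * specProj B b) +
          (((1 - α) / 2 : ℝ) : ℂ) • (specProj B b * specProj A a))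
    refine (hasSum_opJointProb hu a b).unique ?_
    have hinj : Function.Injective fun k : κ => ((⟨a, ha⟩, k) : spectrum ℝ A × κ) :=
      fun _ _ h => (Prod.ext_iff.1 h).2
    refine ((hinj.hasSum_iff ?_).2 h).congr_fun fun k => ?_
    -- For a' ≠ a, P_A(a) annihilates P_A(a') uₖ: directly in one ordering, after moving it to the
    -- left argument in the other.
    · rintro ⟨a', k⟩ hk
      have hne : a ≠ a' := by
        rintro rfl
        exact hk ⟨k, rfl⟩
      have h0 : specProj A a (specProj A a' (u k)) = 0 :=
        specProj_eq_zero_of_ne hA hne (apply_specProj A a' (u k))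
      simp [h0, ← inner_specProj_left A]
    · simp only [Function.comp_apply, add_apply, smul_apply, mul_apply_eq_comp,
        inner_add_right, inner_smul_right, specProj_specProj]
      rw [← inner_specProj_left A, specProj_specProj, inner_specProj_self, ← add_mul,
        ← Complex.ofReal_add]
      ring_nf
      simp
  · rw [opJointProb_eq_zero_of_notMem_left ha, specProj_eq_zero_of_notMem ha]
    simp [trace]

end Measurement

end QuasiJoint

theorem mainTheorem7 {H : Type*} [NormedAddCommGroup H] [InnerProductSpace ℂ H] [CompleteSpace H]
    (A B : H →L[ℂ] H) (hA : IsSelfAdjoint A) (hA_cpt : IsCompactOperator A)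
    (hB : IsSelfAdjoint B) (hB_cpt : IsCompactOperator B)
    (ρ : H →L[ℂ] H) (hρ : QuasiJoint.IsState ρ) :
    -- the post-measurement state is well defined
    (Summable (fun a : spectrum ℝ A => QuasiJoint.luders A a ρ) ∧
      QuasiJoint.IsState (QuasiJoint.nonselective A ρ)) ∧
    -- the operational distribution is the quasi-joint distribution of that state:
    -- as a distribution on the plane, at each point, and as an explicit trace
    (∀ α : ℝ,
      (∀ φ : 𝓢(ℝ × ℝ, ℂ),
        HasSum
          (fun p : spectrum ℝ A × spectrum ℝ B =>
            QuasiJoint.opJointProb A B ρ p.1 p.2 * φ ((p.1 : ℝ), (p.2 : ℝ)))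
          (QuasiJoint.quasiJointProb (QuasiJoint.hashedAlpha α A B)
            (QuasiJoint.nonselective A ρ) φ)) ∧
      (∀ a b : ℝ,
        QuasiJoint.HasPointMass
          (QuasiJoint.quasiJointProb (QuasiJoint.hashedAlpha α A B)
            (QuasiJoint.nonselective A ρ))
          (a, b) (QuasiJoint.opJointProb A B ρ a b)) ∧
      (∀ a b : ℝ,
        QuasiJoint.opJointProb A B ρ a b =
          QuasiJoint.trace (QuasiJoint.nonselective A ρ *
            ((((1 + α) / 2 : ℝ) : ℂ) • (QuasiJoint.specProj A a * QuasiJoint.specProj B b) +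
              (((1 - α) / 2 : ℝ) : ℂ) •
                (QuasiJoint.specProj B b * QuasiJoint.specProj A a))))) ∧
    -- the Kirkwood–Dirac distribution of that state is real
    ((∀ φ : 𝓢(ℝ × ℝ, ℂ), (∀ x, (φ x).im = 0) →
        (QuasiJoint.quasiJointProb (QuasiJoint.hashedKD A B)
          (QuasiJoint.nonselective A ρ) φ).im = 0) ∧
      (∀ a b : ℝ,
        (QuasiJoint.trace (QuasiJoint.nonselective A ρ *
          (QuasiJoint.specProj A a * QuasiJoint.specProj B b))).im = 0)) := by
  obtain ⟨u, hu⟩ := hρ.exists_isVectorDecomposition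
  refine ⟨⟨QuasiJoint.summable_luders hA hA_cpt hu,
      QuasiJoint.isState_nonselective hA hA_cpt hu hρ.trace_eq_one⟩,
    fun α => ⟨QuasiJoint.hasSum_quasiJointProb hA hA_cpt hB hB_cpt hu α,
      QuasiJoint.hasPointMass_quasiJointProb hA hA_cpt hB hB_cpt hu α,
      QuasiJoint.opJointProb_eq_trace hA hA_cpt hu α⟩,
    fun φ hφ => ?_, fun a b => ?_⟩
  · have h := QuasiJoint.hasSum_quasiJointProb hA hA_cpt hB hB_cpt hu 1 φ
    rw [QuasiJoint.hashedAlpha_one] at h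
    -- Each term is a real weight times a real value of φ, so the series of imaginary parts vanishes
    -- termwise.
    refine (Complex.hasSum_im h).unique (hasSum_zero.congr_fun fun p => ?_)
    rw [Complex.mul_im, hφ, QuasiJoint.opJointProb_im hu, mul_zero, zero_mul, add_zero]
  -- At α = 1 the second ordering has coefficient zero.
  · have h := QuasiJoint.opJointProb_eq_trace (B := B) hA hA_cpt hu 1 a b
    norm_num at h
    rw [← h, QuasiJoint.opJointProb_im hu]
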